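/- Let $G$ be a compact Hausdorff Abelian topological group with its Haar probability measure $\mu$ (the regular Haar measure with $\mu(G)=1$), and let $G^\wedge$ be its dual group of continuous homomorphisms $\xi:G\to\mathbb S^1$, which is discrete and is equipped with the counting measure $\nu$. Let $p:G^\wedge\times G^\wedge\to[0,\infty)$ be a continuous invariant pseudo-metric on $G^\wedge$, that is, $p(\zeta\xi,\zeta\eta)=p(\xi,\eta)$ for all $\zeta,\xi,\eta\in G^\wedge$, and put $\gamma(\xi):=p(\xi,1)$. For $f\in L^2(G;\mu)$ (complex-valued) let $\widehat f(\xi):=\int_G f(x)\,\overline{\xi(x)}\,d\mu(x)$, and let $$H^1_\gamma(G):=\Big\{f\in L^2(G;\mu)\;:\;\int_{G^\wedge}(1+\gamma(\xi)^2)\,|\widehat f(\xi)|^2\,d\nu(\xi)<\infty\Big\},\qquad \|f\|_{H^1_\gamma(G)}:=\Big(\int_{G^\wedge}(1+\gamma(\xi)^2)\,|\widehat f(\xi)|^2\,d\nu(\xi)\Big)^{1/2}.$$ Then $H^1_\gamma(G)$ is compactly embedded in $L^2(G;\mu)$ (that is, the inclusion is continuous and every sequence that is bounded in $H^1_\gamma(G)$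 has a subsequence that converges in $L^2(G;\mu)$) if and only if the bounded linear operator $$T:L^2(G^\wedge;\nu)\to L^2(G^\wedge;\nu),\qquad [T(f)](\xi):=\frac{f(\xi)}{\sqrt{1+\gamma(\xi)^2}},$$ is compact. -/

import Mathlib

open MeasureTheory Filter Topology

noncomputable section

namespace SobolevGroup

/-- The dual group `G^∧ = PontryaginDual G` (continuous homomorphisms from `G` to the unit circle)
carries its Borel σ-algebra. -/
instance instMeasurableSpaceDual (G : Type*) [Monoid G] [TopologicalSpace G] :
    MeasurableSpace (PontryaginDual G) := borel _

instance instBorelSpaceDual (G : Type*) [Monoid G] [TopologicalSpace G] :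
    BorelSpace (PontryaginDual G) := ⟨rfl⟩

/-- The dual of a compact group is discrete, so every subset of it is a Borel set. -/
instance instDiscreteMeasurableSpaceDual (G : Type*) [Monoid G] [TopologicalSpace G]
    [CompactSpace G] : DiscreteMeasurableSpace (PontryaginDual G) :=
  ⟨fun s => (isOpen_discrete s).measurableSet⟩

/-- A continuous invariant pseudo-metric on a topological (Abelian) group `Γ`. -/
structure InvariantPseudoMetric (Γ : Type*) [CommGroup Γ] [TopologicalSpace Γ] where
  /-- the distance function -/
  dist : Γ → Γ → ℝ
  dist_nonneg : ∀ x y, 0 ≤ dist x y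
  dist_self : ∀ x, dist x x = 0
  dist_symm : ∀ x y, dist x y = dist y x
  dist_triangle : ∀ x y z, dist x z ≤ dist x y + dist y z
  dist_mul_left : ∀ z x y, dist (z * x) (z * y) = dist x y
  continuous_dist : Continuous fun q : Γ × Γ => dist q.1 q.2

/-- `γ(ξ) = p(ξ, 1)`. -/
def InvariantPseudoMetric.gamma {Γ : Type*} [CommGroup Γ] [TopologicalSpace Γ]
    (p : InvariantPseudoMetric Γ) (ξ : Γ) : ℝ := p.dist ξ 1

/-- The Fourier transform `f^(ξ) = ∫ f(x) conj(ξ(x)) dμ(x)` of an integrable function on `G`.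
When `μ` is finite it is defined in this way on all of `L²(G; μ) ⊆ L¹(G; μ)`. -/
def fourierTransform {G : Type*} [Monoid G] [TopologicalSpace G] [MeasurableSpace G]
    (μ : Measure G) (f : G → ℂ) (ξ : PontryaginDual G) : ℂ :=
  ∫ x, f x * starRingEnd ℂ (ξ x : ℂ) ∂μ

theorem fourierTransform_smul {G : Type*} [Monoid G] [TopologicalSpace G] [MeasurableSpace G]
    (μ : Measure G) (c : ℂ) (f : Lp ℂ 2 μ) (ξ : PontryaginDual G) :
    fourierTransform μ (c • f : Lp ℂ 2 μ) ξ = c * fourierTransform μ f ξ := by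
  unfold fourierTransform
  rw [← integral_const_mul]
  refine integral_congr_ae ?_
  filter_upwards [Lp.coeFn_smul c f] with x hx
  rw [hx, Pi.smul_apply, smul_eq_mul, mul_assoc]

section Fourier

variable {G : Type*} [CommGroup G] [TopologicalSpace G] [CompactSpace G] [MeasurableSpace G]
  [BorelSpace G] (μ : Measure G) [IsFiniteMeasure μ]

theorem integrable_mul_conj_character (f : Lp ℂ 2 μ) (ξ : PontryaginDual G) :
    Integrable (fun x => f x * starRingEnd ℂ (ξ x : ℂ)) μ := by
  have hf : Integrable f μ := (Lp.memLp f).integrable (by norm_num)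
  refine hf.mul_bdd (c := 1) ?_ (ae_of_all _ fun x => (by
    rw [RCLike.norm_conj]; exact (Circle.norm_coe (ξ x)).le))
  have hc : Continuous fun x : G => starRingEnd ℂ (ξ x : ℂ) :=
    Complex.continuous_conj.comp (continuous_subtype_val.comp (map_continuous ξ))
  exact hc.measurable.aestronglyMeasurable

theorem fourierTransform_add (f g : Lp ℂ 2 μ) (ξ : PontryaginDual G) :
    fourierTransform μ (f + g : Lp ℂ 2 μ) ξ
      = fourierTransform μ f ξ + fourierTransform μ g ξ := by
  unfold fourierTransform
  rw [← integral_add (integrable_mul_conj_character μ f ξ) (integrable_mul_conj_character μ g ξ)]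
  refine integral_congr_ae ?_
  filter_upwards [Lp.coeFn_add f g] with x hx
  rw [hx, Pi.add_apply, add_mul]

/-- The Sobolev space `H^s_γ(G)` of a compact Abelian group `G`: all `f ∈ L²(G; μ)` such that
`∫ (1 + γ(ξ)²)^s |f^(ξ)|² dν(ξ) < ∞`, where `ν` is the counting measure of the discrete
group `G^∧` (its Haar measure, in the normalization that belongs to `μ(G) = 1`). -/
def sobolevSpace (p : InvariantPseudoMetric (PontryaginDual G)) (s : ℝ) :
    Submodule ℂ (Lp ℂ 2 μ) where
  carrier := {f | Integrable (fun ξ : PontryaginDual G =>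
    (1 + p.gamma ξ ^ 2) ^ s * ‖fourierTransform μ f ξ‖ ^ 2) Measure.count}
  add_mem' := by
    intro f g hf hg
    refine Integrable.mono' ((hf.add hg).const_mul 2)
      (Measurable.of_discrete).aestronglyMeasurable (ae_of_all _ fun ξ => ?_)
    have hw : 0 ≤ (1 + p.gamma ξ ^ 2) ^ s := by positivity
    rw [Real.norm_of_nonneg (by positivity), fourierTransform_add]
    have h1 := norm_add_le (fourierTransform μ f ξ) (fourierTransform μ g ξ)
    have h2 : ‖fourierTransform μ f ξ + fourierTransform μ g ξ‖ ^ 2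
        ≤ 2 * (‖fourierTransform μ f ξ‖ ^ 2 + ‖fourierTransform μ g ξ‖ ^ 2) := by
      nlinarith [sq_nonneg (‖fourierTransform μ f ξ‖ - ‖fourierTransform μ g ξ‖),
        norm_nonneg (fourierTransform μ f ξ + fourierTransform μ g ξ)]
    calc _ ≤ (1 + p.gamma ξ ^ 2) ^ s
          * (2 * (‖fourierTransform μ f ξ‖ ^ 2 + ‖fourierTransform μ g ξ‖ ^ 2)) := by gcongr
      _ = _ := by simp only [Pi.add_apply]; ring
  zero_mem' := by
    have h : ∀ ξ, fourierTransform μ (0 : Lp ℂ 2 μ) ξ = 0 := fun ξ => by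
      simpa using fourierTransform_smul μ 0 (0 : Lp ℂ 2 μ) ξ
    rw [Set.mem_ofPred_eq]
    simp only [h, norm_zero, ne_eq, OfNat.ofNat_ne_zero, not_false_eq_true, zero_pow, mul_zero]
    exact integrable_zero _ _ _
  smul_mem' := by
    intro c f hf
    refine (hf.const_mul (‖c‖ ^ 2)).congr (ae_of_all _ fun ξ => ?_)
    simp only [fourierTransform_smul, norm_mul]
    ring

/-- The norm `‖f‖ = (∫ (1 + γ(ξ)²)^s |f^(ξ)|² dν(ξ))^(1/2)` of `f ∈ H^s_γ(G)`. -/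
def sobolevNorm (p : InvariantPseudoMetric (PontryaginDual G)) (s : ℝ) (f : Lp ℂ 2 μ) : ℝ :=
  (∫ ξ : PontryaginDual G, (1 + p.gamma ξ ^ 2) ^ s * ‖fourierTransform μ f ξ‖ ^ 2
    ∂Measure.count) ^ (1 / 2 : ℝ)

end Fourier

/-- A linear subspace `H` of a normed space `E`, with its own norm `N`, is compactly embedded
in `E`: the inclusion is continuous, and every sequence in `H` that is bounded in the norm `N`
has a subsequence that converges in `E`. -/
def IsCompactlyEmbedded {E : Type*} [NormedAddCommGroup E] [NormedSpace ℂ E]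
    (H : Submodule ℂ E) (N : E → ℝ) : Prop :=
  (∃ C : ℝ, ∀ f ∈ H, ‖f‖ ≤ C * N f) ∧
    ∀ u : ℕ → E, (∀ m, u m ∈ H) → (∃ R : ℝ, ∀ m, N (u m) ≤ R) →
      ∃ (g : E) (φ : ℕ → ℕ), StrictMono φ ∧ Tendsto (fun j => u (φ j)) atTop (𝓝 g)

section Multiplier

variable {G : Type*} [CommGroup G] [TopologicalSpace G] [CompactSpace G]

theorem norm_div_sqrt_le (c : ℝ) (z : ℂ) : ‖z / (Real.sqrt (1 + c ^ 2) : ℂ)‖ ≤ ‖z‖ := by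
  have h : 1 ≤ Real.sqrt (1 + c ^ 2) := Real.one_le_sqrt.2 (by nlinarith [sq_nonneg c])
  rw [norm_div, Complex.norm_real, Real.norm_of_nonneg (by positivity)]
  exact div_le_self (norm_nonneg z) h

theorem memLp_multiplier (p : InvariantPseudoMetric (PontryaginDual G))
    (f : Lp ℂ 2 (Measure.count : Measure (PontryaginDual G))) :
    MemLp (fun ξ : PontryaginDual G => f ξ / (Real.sqrt (1 + p.gamma ξ ^ 2) : ℂ)) 2
      Measure.count :=
  (Lp.memLp f).mono (Measurable.of_discrete).aestronglyMeasurable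
    (ae_of_all _ fun ξ => norm_div_sqrt_le (p.gamma ξ) (f ξ))

/-- The multiplication operator `(T f)(ξ) = f(ξ) / √(1 + γ(ξ)²)` on `L²(G^∧; ν)`, with `ν` the
counting measure. -/
def multiplier (p : InvariantPseudoMetric (PontryaginDual G)) :
    Lp ℂ 2 (Measure.count : Measure (PontryaginDual G)) →L[ℂ]
      Lp ℂ 2 (Measure.count : Measure (PontryaginDual G)) :=
  LinearMap.mkContinuous
    { toFun := fun f => (memLp_multiplier p f).toLp _
      map_add' := by
        intro f g
        rw [← MemLp.toLp_add]
        refine MemLp.toLp_congr _ _ ?_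
        filter_upwards [Lp.coeFn_add f g] with ξ hξ
        simp only [hξ, Pi.add_apply, add_div]
      map_smul' := by
        intro c f
        rw [RingHom.id_apply, ← MemLp.toLp_const_smul]
        refine MemLp.toLp_congr _ _ ?_
        filter_upwards [Lp.coeFn_smul c f] with ξ hξ
        simp only [hξ, Pi.smul_apply, smul_eq_mul, mul_div_assoc] }
    1 (by
      intro f
      rw [one_mul]
      refine Lp.norm_le_norm_of_ae_le ?_
      filter_upwards [(memLp_multiplier p f).coeFn_toLp] with ξ hξ
      exact (congrArg norm hξ).trans_le (norm_div_sqrt_le (p.gamma ξ) (f ξ)))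

end Multiplier

end SobolevGroup

end

/-! Plancherel's unitary `plancherel` carries `L²(G; μ)` onto `L²(G^∧; ν)`. Through it `H^1_γ(G)`
becomes the range of `T`, and if `f^ = T g` then the Sobolev norm of `f` is `‖g‖`. So the inclusion
of `H^1_γ(G)` is `T` up to unitaries, and both are compact together
(`mem_sobolevSpace_of_multiplier_eq`, `exists_multiplier_eq`).

What takes work is completeness of the characters. Let `W` be their orthogonal complement.
Convolution with a continuous `k` satisfying `k x⁻¹ = conj (k x)` is compact and symmetric and
preserves `W`. An eigenspace in `W` for a nonzero eigenvalue would be finite-dimensional,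
translation-invariant and made of continuous functions. A common eigenvector of all translations in
it would be a multiple of a character, which is absurd. So every such convolution kills `W`;
evaluation at `1` and density of the continuous functions give `W = 0`. -/

noncomputable section

namespace SobolevGroup

open scoped InnerProductSpace ComplexConjugate

/-! ### Common eigenvectors and compact operators -/

section Abstract

/-- Commuting endomorphisms that preserve a nonzero finite-dimensional subspace have a common
eigenvector in it. -/
theorem exists_common_eigenvector {ι V : Type*} [AddCommGroup V] [Module ℂ V]
    (T : ι → Module.End ℂ V) (hT : ∀ i j, Commute (T i) (T j)) (F : Submodule ℂ V)
    [FiniteDimensional ℂ F] (hF : F ≠ ⊥) (hTF : ∀ i, ∀ v ∈ F, T i v ∈ F) :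
    ∃ v ∈ F, v ≠ 0 ∧ ∀ i, ∃ c : ℂ, T i v = c • v := by
  induction hn : Module.finrank ℂ F using Nat.strong_induction_on generalizing F with
  | _ n ih =>
  -- If all `T i` are scalar on `F`, any nonzero vector works. Otherwise an eigenspace of a
  -- non-scalar `T i` cuts out a smaller nonzero subspace, which the commuting operators preserve.
  by_cases h : ∀ i, ∃ c : ℂ, ∀ v ∈ F, T i v = c • v
  · obtain ⟨v, hv, hv0⟩ := F.exists_mem_ne_zero_of_ne_bot hF
    exact ⟨v, hv, hv0, fun i => (h i).imp fun c hc => hc v hv⟩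
  push Not at h
  obtain ⟨i, hi⟩ := h
  have : Nontrivial F := Submodule.nontrivial_iff_ne_bot.2 hF
  obtain ⟨c, hc⟩ := Module.End.exists_eigenvalue ((T i).restrict (hTF i))
  obtain ⟨w, hw⟩ := hc.exists_hasEigenvector
  have hw1 : T i w = c • (w : V) := congrArg Subtype.val hw.apply_eq_smul
  set F' : Submodule ℂ V := F ⊓ Module.End.eigenspace (T i) c with hF'
  have hle : F' ≤ F := inf_le_left
  have : FiniteDimensional ℂ F' := Submodule.finiteDimensional_of_le hle
  have hlt : F' < F := by
    refine lt_of_le_of_ne hle fun he => ?_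
    obtain ⟨v, hv, hvc⟩ := hi c
    exact hvc (Module.End.mem_eigenspace_iff.1 (he.ge hv).2)
  have hne : F' ≠ ⊥ := by
    refine (Submodule.ne_bot_iff _).2 ⟨w, ⟨w.2, Module.End.mem_eigenspace_iff.2 hw1⟩, ?_⟩
    exact fun h0 => hw.2 (Subtype.ext h0)
  obtain ⟨v, hv, h0, hvc⟩ := ih _ (hn ▸ Submodule.finrank_lt_finrank_of_lt hlt) F' hne
    (fun j v hv => ⟨hTF j v hv.1, Module.End.mem_eigenspace_iff.2 (by
      have h1 : T i (T j v) = T j (T i v) := congrArg (fun S : Module.End ℂ V => S v) (hT i j).eq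
      rw [h1, Module.End.mem_eigenspace_iff.1 hv.2, map_smul])⟩) rfl
  exact ⟨v, hle hv, h0, hvc⟩

/-- A compact symmetric operator vanishes on every closed invariant subspace that contains no
eigenvector with a nonzero eigenvalue. -/
theorem eq_zero_of_isCompactOperator_of_isSymmetric {H : Type*} [NormedAddCommGroup H]
    [InnerProductSpace ℂ H] {T : H →L[ℂ] H} (hT : IsCompactOperator T)
    (hsymm : (T : H →ₗ[ℂ] H).IsSymmetric) (W : Submodule ℂ H) [CompleteSpace W]
    (hTW : ∀ v ∈ W, T v ∈ W) (h : ∀ c : ℂ, c ≠ 0 → ∀ w ∈ W, T w = c • w → w = 0)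
    {v : H} (hv : v ∈ W) : T v = 0 := by
  have hS : T.restrict hTW = 0 := by
    refine (ContinuousLinearMap.eq_zero_of_forall_hasEigenvalue_eq_zero
      (hT.restrict' hTW) (hsymm.restrict_invariant hTW)).1 fun c hc => ?_
    by_contra hc0
    obtain ⟨w, hw⟩ := hc.exists_hasEigenvector
    exact hw.2 (Subtype.ext (h c hc0 w w.2 (congrArg Subtype.val hw.apply_eq_smul)))
  exact congrArg Subtype.val (DFunLike.congr_fun hS ⟨v, hv⟩)

variable {X H : Type*} [TopologicalSpace X] [CompactSpace X] [NormedAddCommGroup H]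
  [InnerProductSpace ℂ H]

/-- The operator `f ↦ (x ↦ ⟪κ x, f⟫)` into the continuous functions. -/
def kernelOperator (κ : C(X, H)) : H →L[ℂ] C(X, ℂ) :=
  LinearMap.mkContinuous
    { toFun := fun f => ⟨fun x => ⟪κ x, f⟫_ℂ, by fun_prop⟩
      map_add' := fun f g => by ext x; simp
      map_smul' := fun c f => by ext x; simp }
    ‖κ‖ fun f => by
      refine (ContinuousMap.norm_le _ (by positivity)).2 fun x => ?_
      exact (norm_inner_le_norm _ _).trans (by gcongr; exact κ.norm_coe_le_norm x)

@[simp]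
theorem kernelOperator_apply (κ : C(X, H)) (f : H) (x : X) :
    kernelOperator κ f x = ⟪κ x, f⟫_ℂ := rfl

/-- Arzelà–Ascoli: by Cauchy–Schwarz the image of the unit ball is bounded by `‖κ‖`, and continuity
of `κ` makes it equicontinuous. -/
theorem isCompactOperator_kernelOperator (κ : C(X, H)) :
    IsCompactOperator (kernelOperator κ) := by
  refine (isCompactOperator_iff_isCompact_closure_image_closedBall
    (kernelOperator κ : H →ₗ[ℂ] C(X, ℂ)) zero_lt_one).2 ?_
  let I := ContinuousMap.isometryEquivBoundedOfCompact X ℂ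
  set S : Set C(X, ℂ) := kernelOperator κ '' Metric.closedBall 0 1 with hS
  have key : IsCompact (closure (I '' S)) := by
    refine BoundedContinuousFunction.arzela_ascoli (Metric.closedBall (0 : ℂ) ‖κ‖)
      (isCompact_closedBall _ _) _ ?_ ?_
    · rintro _ x ⟨_, ⟨f, hf, rfl⟩, rfl⟩
      rw [mem_closedBall_zero_iff] at hf ⊢
      calc ‖⟪κ x, f⟫_ℂ‖ ≤ ‖κ x‖ * ‖f‖ := norm_inner_le_norm _ _
        _ ≤ ‖κ‖ * 1 := by gcongr; exact κ.norm_coe_le_norm x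
        _ = ‖κ‖ := mul_one _
    · intro x
      rw [Metric.equicontinuousAt_iff_right]
      intro ε hε
      filter_upwards [Metric.tendsto_nhds.1 (κ.continuous.tendsto x) ε hε] with y hy
      rintro ⟨_, _, ⟨f, hf, rfl⟩, rfl⟩
      rw [mem_closedBall_zero_iff] at hf
      change dist ⟪κ x, f⟫_ℂ ⟪κ y, f⟫_ℂ < ε
      rw [dist_eq_norm, ← inner_sub_left]
      calc _ ≤ ‖κ x - κ y‖ * ‖f‖ := norm_inner_le_norm _ _
        _ ≤ ‖κ x - κ y‖ * 1 := by gcongr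
        _ < ε := by rwa [mul_one, ← dist_eq_norm, dist_comm]
  rw [← I.toHomeomorph.isCompact_image, I.toHomeomorph.image_closure]
  exact key

end Abstract

/-! ### Completeness of the characters -/

section PeterWeyl

variable {G : Type*} [CommGroup G] [TopologicalSpace G] [IsTopologicalGroup G]
  [CompactSpace G] [MeasurableSpace G] [BorelSpace G]

/-- The class in `L²(G; μ)` of a continuous function. -/
abbrev toL2 (μ : Measure G) [IsFiniteMeasure μ] : C(G, ℂ) →L[ℂ] Lp ℂ 2 μ :=
  ContinuousMap.toLp 2 μ ℂ

theorem inner_toL2 (μ : Measure G) [IsFiniteMeasure μ] (h : C(G, ℂ)) (f : Lp ℂ 2 μ) :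
    ⟪toL2 μ h, f⟫_ℂ = ∫ x, f x * conj (h x) ∂μ := by
  rw [L2.inner_def]
  refine integral_congr_ae ?_
  filter_upwards [ContinuousMap.coeFn_toLp (p := 2) (𝕜 := ℂ) μ h] with x hx
  rw [hx, RCLike.inner_apply]

/-- A character of `G` as a continuous complex function. -/
def characterMap (ξ : PontryaginDual G) : C(G, ℂ) :=
  ⟨fun x => (ξ x : ℂ), continuous_subtype_val.comp (map_continuous ξ)⟩

@[simp]
theorem characterMap_apply (ξ : PontryaginDual G) (x : G) : characterMap ξ x = (ξ x : ℂ) := rfl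

theorem fourierTransform_eq_inner (μ : Measure G) [IsFiniteMeasure μ] (f : Lp ℂ 2 μ)
    (ξ : PontryaginDual G) :
    fourierTransform μ f ξ = ⟪toL2 μ (characterMap ξ), f⟫_ℂ := by
  rw [inner_toL2]; rfl

/-- The translate `x ↦ f (y x)`, as a linear map in `f`. -/
def translate (y : G) : Module.End ℂ C(G, ℂ) where
  toFun f := ⟨fun x => f (y * x), by fun_prop⟩
  map_add' _ _ := rfl
  map_smul' _ _ := rfl

@[simp]
theorem translate_apply (y : G) (f : C(G, ℂ)) (x : G) : translate y f x = f (y * x) := rfl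

theorem commute_translate (y z : G) : Commute (translate y) (translate z) := by
  ext f x
  change f (z * (y * x)) = f (y * (z * x))
  rw [mul_left_comm]

/-- A nonzero continuous function that is an eigenvector of all translations is a multiple of a
character. -/
theorem exists_character_of_translate_eigenvector {f : C(G, ℂ)} (hf : f ≠ 0)
    (h : ∀ y, ∃ c : ℂ, translate y f = c • f) :
    ∃ ξ : PontryaginDual G, f = f 1 • characterMap ξ := by
  choose c hc using h
  have hcf : ∀ y x, f (y * x) = c y * f x := fun y x => congrArg (fun g : C(G, ℂ) => g x) (hc y)
  have hf1 : ∀ y, f y = c y * f 1 := fun y => by simpa using hcf y 1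
  have h1 : f 1 ≠ 0 := fun h0 => hf (by ext y; simp [hf1 y, h0])
  have hmul : ∀ x y, c (x * y) = c x * c y := fun x y => by
    apply mul_right_cancel₀ h1
    rw [← hf1, hcf, hf1 y, mul_assoc]
  have hone : c 1 = 1 := mul_right_cancel₀ h1 (by rw [← hf1, one_mul])
  -- Translation does not increase the sup norm; the bound at both `y` and `y⁻¹` then forces `‖c y‖
  -- = 1`.
  have hle : ∀ y, ‖c y‖ ≤ 1 := fun y => by
    have hb : ‖c y‖ * ‖f‖ ≤ ‖f‖ := by
      rw [← norm_smul, ← hc]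
      exact (ContinuousMap.norm_le _ (norm_nonneg f)).2 fun x => f.norm_coe_le_norm (y * x)
    exact le_of_mul_le_mul_right (by rwa [one_mul]) (norm_pos_iff.2 hf)
  have hnorm : ∀ y, ‖c y‖ = 1 := fun y => by
    refine le_antisymm (hle y) ?_
    have h2 : ‖c y‖ * ‖c y⁻¹‖ = 1 := by rw [← norm_mul, ← hmul, mul_inv_cancel, hone, norm_one]
    nlinarith [hle y⁻¹, norm_nonneg (c y)]
  have hcont : Continuous c := by
    have : c = fun y => f y / f 1 := funext fun y => by rw [hf1 y, mul_div_cancel_right₀ _ h1]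
    rw [this]
    fun_prop
  let χ : G →ₜ* Circle :=
    { toFun := fun y => ⟨c y, mem_sphere_zero_iff_norm.2 (hnorm y)⟩
      map_one' := Subtype.ext hone
      map_mul' := fun x y => Subtype.ext (hmul x y)
      continuous_toFun := hcont.subtype_mk _ }
  refine ⟨χ, ?_⟩
  ext y
  rw [hf1 y, mul_comm]
  rfl

/-- The kernel `x ↦ (y ↦ conj (k (x / y)))`. -/
def convolutionKernel (μ : Measure G) [IsFiniteMeasure μ] (k : C(G, ℂ)) : C(G, Lp ℂ 2 μ) :=
  (⟨toL2 μ, (toL2 μ).continuous⟩ : C(C(G, ℂ), Lp ℂ 2 μ)).comp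
    (ContinuousMap.curry ⟨fun q : G × G => conj (k (q.1 / q.2)), by fun_prop⟩)

/-- Convolution with a continuous function, as an operator from `L²` to the continuous
functions. -/
def convolution (μ : Measure G) [IsFiniteMeasure μ] (k : C(G, ℂ)) : Lp ℂ 2 μ →L[ℂ] C(G, ℂ) :=
  kernelOperator (convolutionKernel μ k)

theorem convolution_apply (μ : Measure G) [IsFiniteMeasure μ] (k : C(G, ℂ)) (f : Lp ℂ 2 μ)
    (x : G) : convolution μ k f x = ∫ y, f y * k (x / y) ∂μ := by
  rw [convolution, kernelOperator_apply, convolutionKernel, ContinuousMap.comp_apply,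
    ContinuousMap.coe_mk, inner_toL2]
  simp

theorem convolution_toL2_apply (μ : Measure G) [IsFiniteMeasure μ] (k f : C(G, ℂ)) (x : G) :
    convolution μ k (toL2 μ f) x = ∫ y, f y * k (x / y) ∂μ := by
  rw [convolution_apply]
  refine integral_congr_ae ?_
  filter_upwards [ContinuousMap.coeFn_toLp (p := 2) (𝕜 := ℂ) μ f] with y hy
  rw [hy]

/-- Convolution with a continuous function, as an operator on `L²`. -/
def convolutionL2 (μ : Measure G) [IsFiniteMeasure μ] (k : C(G, ℂ)) : Lp ℂ 2 μ →L[ℂ] Lp ℂ 2 μ :=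
  (toL2 μ).comp (convolution μ k)

theorem isCompactOperator_convolutionL2 (μ : Measure G) [IsFiniteMeasure μ] (k : C(G, ℂ)) :
    IsCompactOperator (convolutionL2 μ k) :=
  (isCompactOperator_kernelOperator _).clm_comp (toL2 μ)

theorem isSymmetric_convolutionL2 [T2Space G] (μ : Measure G) [IsFiniteMeasure μ] [μ.Regular]
    {k : C(G, ℂ)} (hk : ∀ x, k x⁻¹ = conj (k x)) :
    (convolutionL2 μ k : Lp ℂ 2 μ →ₗ[ℂ] Lp ℂ 2 μ).IsSymmetric := by
  have hd := ContinuousMap.toLp_denseRange (p := 2) ℂ μ ℂ (by norm_num)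
  intro f g
  change ⟪convolutionL2 μ k f, g⟫_ℂ = ⟪f, convolutionL2 μ k g⟫_ℂ
  refine hd.induction_on₂ (p := fun f g => ⟪convolutionL2 μ k f, g⟫_ℂ = ⟪f, convolutionL2 μ k g⟫_ℂ)
    (isClosed_eq (by fun_prop) (by fun_prop)) ?_ f g
  intro f g
  change ⟪toL2 μ (convolution μ k (toL2 μ f)), toL2 μ g⟫_ℂ
    = ⟪toL2 μ f, toL2 μ (convolution μ k (toL2 μ g))⟫_ℂ
  rw [ContinuousMap.inner_toLp, ContinuousMap.inner_toLp]
  simp only [convolution_toL2_apply, ← integral_conj, ← integral_const_mul, ← integral_mul_const]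
  -- For continuous integrands this exchange needs no second countability of `G`; hence the
  -- reduction to continuous `f` and `g`.
  rw [integral_integral_swap_of_hasCompactSupport]
  · refine integral_congr_ae (ae_of_all _ fun x => integral_congr_ae (ae_of_all _ fun y => ?_))
    have := hk (x / y)
    rw [inv_div] at this
    simp [this]
    ring
  · fun_prop
  · exact HasCompactSupport.of_compactSpace _

variable (μ : Measure G) [μ.IsHaarMeasure]

theorem translate_convolution [IsFiniteMeasure μ] (k f : C(G, ℂ)) (y : G) :
    convolution μ k (toL2 μ (translate y f)) = translate y (convolution μ k (toL2 μ f)) := by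
  ext x
  rw [translate_apply, convolution_toL2_apply, convolution_toL2_apply,
    ← integral_mul_left_eq_self (fun z => f z * k (y * x / z)) y]
  simp [mul_div_mul_left_eq_div]

theorem inner_characterMap_translate [IsFiniteMeasure μ] (f : C(G, ℂ)) (ξ : PontryaginDual G) (y : G) :
    ⟪toL2 μ (characterMap ξ), toL2 μ (translate y f)⟫_ℂ
      = ξ y * ⟪toL2 μ (characterMap ξ), toL2 μ f⟫_ℂ := by
  rw [ContinuousMap.inner_toLp, ContinuousMap.inner_toLp,
    ← integral_mul_left_eq_self (fun z => f z * conj (characterMap ξ z)) y, ← integral_const_mul]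
  refine integral_congr_ae (ae_of_all _ fun x => ?_)
  have h : (ξ y : ℂ) * conj (ξ y : ℂ) = 1 := by
    rw [Complex.mul_conj, Circle.normSq_coe, Complex.ofReal_one]
  simp only [translate_apply, characterMap_apply, map_mul, Circle.coe_mul]
  linear_combination -(f (y * x) * conj (ξ x : ℂ)) * h

theorem orthonormal_characterMap [IsProbabilityMeasure μ] :
    Orthonormal ℂ fun ξ : PontryaginDual G => toL2 μ (characterMap ξ) := by
  classical
  rw [orthonormal_iff_ite]
  intro ξ η
  split_ifs with h
  · subst h
    rw [ContinuousMap.inner_toLp]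
    simp [Complex.mul_conj]
  · have hne : ∃ y, ξ y ≠ η y := by
      by_contra! hc
      exact h (PontryaginDual.ext hc)
    obtain ⟨y, hy⟩ := hne
    have h1 : translate y (characterMap η) = (η y : ℂ) • characterMap η := by
      ext x; simp
    have h2 := inner_characterMap_translate μ (characterMap η) ξ y
    rw [h1, map_smul, inner_smul_right] at h2
    -- The inner product is multiplied by the same amount by `ξ y` and by `η y`, so it vanishes.
    by_contra h0
    exact hy (Circle.ext (mul_right_cancel₀ h0 h2).symm)

/-- The substitution `y ↦ x / y` gives the Fourier coefficient of `k` as eigenvalue. With symmetry,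
this makes `characterOrthogonal μ` invariant. -/
theorem convolution_characterMap [IsFiniteMeasure μ] [μ.Regular] (k : C(G, ℂ))
    (ξ : PontryaginDual G) :
    ∃ c : ℂ, convolutionL2 μ k (toL2 μ (characterMap ξ)) = c • toL2 μ (characterMap ξ) := by
  refine ⟨∫ y, conj (ξ y : ℂ) * k y ∂μ, ?_⟩
  rw [convolutionL2, ContinuousLinearMap.comp_apply, ← map_smul]
  congr 1
  ext x
  rw [convolution_toL2_apply,
    ← integral_div_left_eq_self (fun z => characterMap ξ z * k (x / z)) μ x]
  simp only [ContinuousMap.smul_apply, smul_eq_mul, ← integral_mul_const]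
  refine integral_congr_ae (ae_of_all _ fun y => ?_)
  simp [div_eq_mul_inv, ← Circle.coe_inv_eq_conj]
  ring

/-- The functions in `L²(G; μ)` that are orthogonal to all characters. -/
def characterOrthogonal [IsFiniteMeasure μ] : Submodule ℂ (Lp ℂ 2 μ) :=
  (Submodule.span ℂ (Set.range fun ξ : PontryaginDual G => toL2 μ (characterMap ξ)))ᗮ

theorem mem_characterOrthogonal [IsFiniteMeasure μ] {g : Lp ℂ 2 μ} :
    g ∈ characterOrthogonal μ ↔ ∀ ξ : PontryaginDual G, ⟪toL2 μ (characterMap ξ), g⟫_ℂ = 0 := by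
  rw [characterOrthogonal, Submodule.mem_orthogonal]
  refine ⟨fun h ξ => h _ (Submodule.subset_span ⟨ξ, rfl⟩), fun h u hu => ?_⟩
  induction hu using Submodule.span_induction with
  | mem u hu => obtain ⟨ξ, rfl⟩ := hu; exact h ξ
  | zero => exact inner_zero_left _
  | add u v _ _ hu hv => rw [inner_add_left, hu, hv, add_zero]
  | smul c u _ hu => rw [inner_smul_left, hu, mul_zero]

theorem eq_zero_of_convolutionL2_eq_smul [IsFiniteMeasure μ] {k : C(G, ℂ)} {c : ℂ} (hc : c ≠ 0)
    {w : Lp ℂ 2 μ} (hwW : w ∈ characterOrthogonal μ) (hw : convolutionL2 μ k w = c • w) :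
    w = 0 := by
  have hinj := ContinuousMap.toLp_injective (E := ℂ) (p := 2) (𝕜 := ℂ) μ
  have hfin := ContinuousLinearMap.finite_dimensional_eigenspace
    (isCompactOperator_convolutionL2 μ k) c hc
  by_contra hw0
  set V : Submodule ℂ (Lp ℂ 2 μ) :=
    Module.End.eigenspace (convolutionL2 μ k).toLinearMap c with hV
  let F₀ : Submodule ℂ C(G, ℂ) := V.comap (toL2 μ).toLinearMap
  have hF₀ : FiniteDimensional ℂ F₀ :=
    FiniteDimensional.of_injective ((toL2 μ).toLinearMap.restrict (p := F₀) (q := V) fun _ h => h)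
      fun a b hab => Subtype.ext (hinj (congrArg Subtype.val hab))
  let F : Submodule ℂ C(G, ℂ) := F₀ ⊓ (characterOrthogonal μ).comap (toL2 μ).toLinearMap
  have hF : FiniteDimensional ℂ F := Submodule.finiteDimensional_of_le inf_le_left
  have memF : ∀ g, g ∈ F ↔ convolution μ k (toL2 μ g) = c • g ∧
      toL2 μ g ∈ characterOrthogonal μ := fun g => by
    refine and_congr_left fun _ => Module.End.mem_eigenspace_iff.trans ?_
    rw [← hinj.eq_iff, map_smul]
    rfl
  have hBw : toL2 μ (convolution μ k w) = c • w := hw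
  have hFne : F ≠ ⊥ := by
    -- As `c ≠ 0`, the eigenvector `w` has a continuous representative up to the factor `c`.
    refine (Submodule.ne_bot_iff _).2 ⟨convolution μ k w, (memF _).2 ⟨?_, ?_⟩, fun h => ?_⟩
    · rw [hBw, map_smul]
    · rw [hBw]; exact Submodule.smul_mem _ c hwW
    · rw [h, map_zero] at hBw
      exact (smul_ne_zero hc hw0) hBw.symm
  obtain ⟨g, hgF, hg0, hg⟩ := exists_common_eigenvector (translate (G := G)) commute_translate F
    hFne fun y g hg => by
      rw [memF, mem_characterOrthogonal] at hg ⊢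
      refine ⟨by rw [translate_convolution, hg.1, map_smul], fun ξ => ?_⟩
      rw [inner_characterMap_translate, hg.2, mul_zero]
  obtain ⟨ξ, hξ⟩ := exists_character_of_translate_eigenvector hg0 hg
  have h1 := (mem_characterOrthogonal μ).1 ((memF g).1 hgF).2 ξ
  have h2 : ⟪toL2 μ g, toL2 μ g⟫_ℂ = 0 := by
    nth_rw 1 [hξ]
    rw [map_smul, inner_smul_left, h1, mul_zero]
  exact hg0 (hinj (by rw [inner_self_eq_zero.1 h2, map_zero]))

theorem convolutionL2_eq_zero [T2Space G] [IsFiniteMeasure μ] [μ.Regular] {k : C(G, ℂ)}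
    (hk : ∀ x, k x⁻¹ = conj (k x)) {f : Lp ℂ 2 μ} (hf : f ∈ characterOrthogonal μ) :
    convolutionL2 μ k f = 0 := by
  have hsymm := isSymmetric_convolutionL2 μ hk
  have hTW : ∀ g ∈ characterOrthogonal μ, convolutionL2 μ k g ∈ characterOrthogonal μ := by
    intro g hg
    rw [mem_characterOrthogonal] at hg ⊢
    intro ξ
    obtain ⟨c, hc⟩ := convolution_characterMap μ k ξ
    have := hsymm (toL2 μ (characterMap ξ)) g
    simp only [ContinuousLinearMap.coe_coe] at this
    rw [← this, hc, inner_smul_left, hg, mul_zero]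
  have : CompleteSpace (characterOrthogonal μ) :=
    (Submodule.isClosed_orthogonal _).completeSpace_coe
  exact eq_zero_of_isCompactOperator_of_isSymmetric (isCompactOperator_convolutionL2 μ k) hsymm
    (characterOrthogonal μ) hTW (fun c hc w hw => eq_zero_of_convolutionL2_eq_smul μ hc hw) hf

theorem eq_zero_of_inner_characterMap_eq_zero [T2Space G] [IsFiniteMeasure μ] [μ.Regular]
    {f : Lp ℂ 2 μ} (hf : ∀ ξ : PontryaginDual G, ⟪toL2 μ (characterMap ξ), f⟫_ℂ = 0) : f = 0 := by
  have hconv : ∀ k : C(G, ℂ), (∀ x, k x⁻¹ = conj (k x)) → convolution μ k f = 0 := fun k hk =>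
    ContinuousMap.toLp_injective (p := 2) (𝕜 := ℂ) μ
      ((convolutionL2_eq_zero μ hk ((mem_characterOrthogonal μ).2 hf)).trans (map_zero _).symm)
  have hint : ∀ k : C(G, ℂ), (∀ x, k x⁻¹ = conj (k x)) → ⟪toL2 μ k, f⟫_ℂ = 0 := fun k hk => by
    -- At `1` the convolution is `∫ f y * k y⁻¹`, and `k y⁻¹ = conj (k y)`.
    have := congrArg (fun g : C(G, ℂ) => g 1) (hconv k hk)
    rw [inner_toL2]
    simpa [convolution_apply, hk] using this
  have hall : ∀ k : C(G, ℂ), ⟪toL2 μ k, f⟫_ℂ = 0 := fun k => by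
    -- Both `k + k'` and `I • (k - k')` have the required symmetry, and together they recover `k`.
    let k' : C(G, ℂ) := ⟨fun x => conj (k x⁻¹), by fun_prop⟩
    have h1 := hint (k + k') fun x => by simp [k', add_comm]
    have h2 := hint (Complex.I • (k - k')) fun x => by
      simp only [k', ContinuousMap.smul_apply, ContinuousMap.sub_apply, ContinuousMap.coe_mk, inv_inv,
        smul_eq_mul, map_mul, map_sub, Complex.conj_conj, Complex.conj_I]
      ring
    rw [map_add, inner_add_left] at h1
    rw [map_smul, inner_smul_left, map_sub, inner_sub_left] at h2
    have h3 := (mul_eq_zero.1 h2).resolve_left (by simp)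
    linear_combination (h1 + h3) / 2
  have hd := ContinuousMap.toLp_denseRange (p := 2) ℂ μ ℂ (by norm_num)
  refine hd.induction_on (p := fun g => ⟪g, f⟫_ℂ = 0) _ ?_ ?_ |> inner_self_eq_zero.1
  · exact isClosed_eq (by fun_prop) continuous_const
  · exact hall

/-- The characters form a Hilbert basis of `L²(G; μ)`. -/
def characterBasis [T2Space G] [IsProbabilityMeasure μ] [μ.Regular] :
    HilbertBasis (PontryaginDual G) ℂ (Lp ℂ 2 μ) :=
  HilbertBasis.mkOfOrthogonalEqBot (orthonormal_characterMap μ) <| by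
    rw [Submodule.eq_bot_iff]
    intro f hf
    exact eq_zero_of_inner_characterMap_eq_zero μ fun ξ =>
      (Submodule.mem_orthogonal _ _).1 hf _ (Submodule.subset_span ⟨ξ, rfl⟩)

theorem characterBasis_repr [T2Space G] [IsProbabilityMeasure μ] [μ.Regular] (f : Lp ℂ 2 μ)
    (ξ : PontryaginDual G) : (characterBasis μ).repr f ξ = fourierTransform μ f ξ := by
  rw [HilbertBasis.repr_apply_apply, characterBasis, HilbertBasis.coe_mkOfOrthogonalEqBot,
    fourierTransform_eq_inner]

end PeterWeyl

/-! ### `L²` of the counting measure, and sequential compactness -/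

theorem integral_count_eq_tsum {X : Type*} [MeasurableSpace X] [DiscreteMeasurableSpace X]
    {f : X → ℝ} (hf : ∀ x, 0 ≤ f x) (hs : Summable f) : ∫ x, f x ∂Measure.count = ∑' x, f x := by
  rw [integral_eq_lintegral_of_nonneg_ae (ae_of_all _ hf)
    Measurable.of_discrete.aestronglyMeasurable, lintegral_count,
    ← ENNReal.ofReal_tsum_of_nonneg hf hs, ENNReal.toReal_ofReal (tsum_nonneg hf)]

theorem memLp_two_count_iff {X : Type*} [MeasurableSpace X] [DiscreteMeasurableSpace X]
    {f : X → ℂ} : MemLp f 2 Measure.count ↔ Summable fun x => ‖f x‖ ^ 2 := by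
  rw [memLp_two_iff_integrable_sq_norm Measurable.of_discrete.aestronglyMeasurable,
    integrable_count_iff]
  simp

theorem norm_sq_eq_integral {X : Type*} [MeasurableSpace X] {ν : Measure X} (g : Lp ℂ 2 ν) :
    ‖g‖ ^ 2 = ∫ x, ‖g x‖ ^ 2 ∂ν := by
  have h : ((‖g‖ ^ 2 : ℝ) : ℂ) = ((∫ x, ‖g x‖ ^ 2 ∂ν : ℝ) : ℂ) := by
    have := inner_self_eq_norm_sq_to_K (𝕜 := ℂ) g
    rw [← integral_complex_ofReal]
    push_cast
    refine this.symm.trans ?_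
    rw [L2.inner_def]
    exact integral_congr_ae (ae_of_all _ fun x => inner_self_eq_norm_sq_to_K (𝕜 := ℂ) (g x))
  exact_mod_cast h

theorem coeFn_toLp_count {X : Type*} [MeasurableSpace X] {f : X → ℂ}
    (hf : MemLp f 2 Measure.count) (x : X) : hf.toLp f x = f x :=
  Measure.ae_count_iff.1 hf.coeFn_toLp x

theorem Lp_count_ext {X : Type*} [MeasurableSpace X] {f g : Lp ℂ 2 (Measure.count : Measure X)}
    (h : ∀ x, f x = g x) : f = g :=
  Lp.ext (ae_of_all _ h)

theorem memℓp_two_iff {X : Type*} {f : X → ℂ} : Memℓp f 2 ↔ Summable fun x => ‖f x‖ ^ 2 := by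
  rw [memℓp_gen_iff (by norm_num)]
  simp

/-- `ℓ²(X)` is `L²(X)` for the counting measure. -/
def lpEquivLpCount (X : Type*) [MeasurableSpace X] [DiscreteMeasurableSpace X] :
    lp (fun _ : X => ℂ) 2 ≃ₗᵢ[ℂ] Lp ℂ 2 (Measure.count : Measure X) where
  toFun f := (memLp_two_count_iff.2 (memℓp_two_iff.1 f.2)).toLp f
  invFun g := ⟨fun x => g x, memℓp_two_iff.2 (memLp_two_count_iff.1 (Lp.memLp g))⟩
  left_inv f := lp.ext (funext fun x => coeFn_toLp_count _ x)
  right_inv g := Lp_count_ext fun x => coeFn_toLp_count _ x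
  map_add' f g := Lp_count_ext fun x => by
    rw [Measure.ae_count_iff.1 (Lp.coeFn_add _ _) x]
    simp only [coeFn_toLp_count, Pi.add_apply, lp.coeFn_add]
  map_smul' c f := Lp_count_ext fun x => by
    rw [Measure.ae_count_iff.1 (Lp.coeFn_smul _ _) x]
    simp only [coeFn_toLp_count, Pi.smul_apply, lp.coeFn_smul, RingHom.id_apply]
  norm_map' f := by
    refine (sq_eq_sq₀ (norm_nonneg _) (norm_nonneg _)).1 ?_
    rw [norm_sq_eq_integral]
    change ∫ x, ‖(memLp_two_count_iff.2 (memℓp_two_iff.1 f.2)).toLp f x‖ ^ 2 ∂Measure.count = _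
    simp only [coeFn_toLp_count]
    rw [integral_count_eq_tsum (fun x => by positivity) (memℓp_two_iff.1 f.2)]
    have := lp.norm_rpow_eq_tsum (p := 2) (by norm_num) f
    simpa using this.symm

theorem lpEquivLpCount_apply {X : Type*} [MeasurableSpace X] [DiscreteMeasurableSpace X]
    (f : lp (fun _ : X => ℂ) 2) (x : X) : lpEquivLpCount X f x = f x :=
  coeFn_toLp_count (memLp_two_count_iff.2 (memℓp_two_iff.1 f.2)) x

/-- A sequence in the closure is shadowed by one in `S` at distance below `1 / (n + 1)`, and limits
of subsequences agree. -/
theorem isCompact_closure_of_subseq {E : Type*} [PseudoMetricSpace E] {S : Set E}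
    (h : ∀ u : ℕ → E, (∀ n, u n ∈ S) →
      ∃ (a : E) (φ : ℕ → ℕ), StrictMono φ ∧ Tendsto (u ∘ φ) atTop (𝓝 a)) :
    IsCompact (closure S) := by
  rw [isCompact_iff_isSeqCompact]
  intro y hy
  have hz : ∀ n : ℕ, ∃ z ∈ S, dist (y n) z < 1 / (n + 1 : ℝ) := fun n =>
    Metric.mem_closure_iff.1 (hy n) _ (by positivity)
  choose z hzS hz using hz
  obtain ⟨a, φ, hφ, ha⟩ := h z hzS
  refine ⟨a, mem_closure_of_tendsto ha (Eventually.of_forall fun n => hzS _), φ, hφ, ?_⟩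
  refine (tendsto_iff_of_dist ?_).2 ha
  refine squeeze_zero (fun _ => dist_nonneg) (fun n => (hz (φ n)).le) ?_
  exact (tendsto_one_div_add_atTop_nhds_zero_nat (𝕜 := ℝ)).comp hφ.tendsto_atTop

section Multiplier

variable {G : Type*} [CommGroup G] [TopologicalSpace G] [CompactSpace G]

theorem multiplier_apply (p : InvariantPseudoMetric (PontryaginDual G))
    (g : Lp ℂ 2 (Measure.count : Measure (PontryaginDual G))) (ξ : PontryaginDual G) :
    multiplier p g ξ = g ξ / (Real.sqrt (1 + p.gamma ξ ^ 2) : ℂ) :=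
  coeFn_toLp_count (memLp_multiplier p g) ξ

theorem norm_multiplier_apply_le (p : InvariantPseudoMetric (PontryaginDual G))
    (g : Lp ℂ 2 (Measure.count : Measure (PontryaginDual G))) : ‖multiplier p g‖ ≤ ‖g‖ :=
  Lp.norm_le_norm_of_ae_le (ae_of_all _ fun ξ => by
    rw [multiplier_apply]
    exact norm_div_sqrt_le _ _)

end Multiplier

/-! ### Plancherel and the Sobolev space as the range of `T` -/

section Fourier

variable {G : Type*} [CommGroup G] [TopologicalSpace G] [IsTopologicalGroup G]
  [CompactSpace G] [T2Space G] [MeasurableSpace G] [BorelSpace G]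
  (μ : Measure G) [μ.IsHaarMeasure] [μ.Regular] [IsProbabilityMeasure μ]

/-- Plancherel's theorem for compact Abelian groups. -/
def plancherel : Lp ℂ 2 μ ≃ₗᵢ[ℂ] Lp ℂ 2 (Measure.count : Measure (PontryaginDual G)) :=
  (characterBasis μ).repr.trans (lpEquivLpCount (PontryaginDual G))

theorem plancherel_apply (f : Lp ℂ 2 μ) (ξ : PontryaginDual G) :
    plancherel μ f ξ = fourierTransform μ f ξ := by
  rw [plancherel, LinearIsometryEquiv.trans_apply, lpEquivLpCount_apply, characterBasis_repr]

variable {μ} (p : InvariantPseudoMetric (PontryaginDual G))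

theorem mem_sobolevSpace_of_multiplier_eq {f : Lp ℂ 2 μ}
    {g : Lp ℂ 2 (Measure.count : Measure (PontryaginDual G))}
    (h : multiplier p g = plancherel μ f) :
    f ∈ sobolevSpace μ p 1 ∧ sobolevNorm μ p 1 f = ‖g‖ := by
  have key : (fun ξ : PontryaginDual G =>
      (1 + p.gamma ξ ^ 2) ^ (1 : ℝ) * ‖fourierTransform μ f ξ‖ ^ 2) = fun ξ => ‖g ξ‖ ^ 2 := by
    funext ξ
    have hw : 0 < 1 + p.gamma ξ ^ 2 := by positivity
    rw [← plancherel_apply, ← h, multiplier_apply, norm_div, Complex.norm_real, div_pow,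
      Real.norm_of_nonneg (Real.sqrt_nonneg _), Real.sq_sqrt hw.le, Real.rpow_one]
    field_simp
  constructor
  · change Integrable _ _
    rw [key]
    exact (memLp_two_iff_integrable_sq_norm (Lp.aestronglyMeasurable g)).1 (Lp.memLp g)
  · rw [sobolevNorm, key, ← norm_sq_eq_integral, ← Real.sqrt_eq_rpow,
      Real.sqrt_sq (norm_nonneg g)]

theorem exists_multiplier_eq {f : Lp ℂ 2 μ} (hf : f ∈ sobolevSpace μ p 1) :
    ∃ g, multiplier p g = plancherel μ f := by
  have hw : ∀ ξ, 0 < 1 + p.gamma ξ ^ 2 := fun ξ => by positivity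
  have hg : MemLp (fun ξ : PontryaginDual G =>
      fourierTransform μ f ξ * (Real.sqrt (1 + p.gamma ξ ^ 2) : ℂ)) 2 Measure.count := by
    rw [memLp_two_iff_integrable_sq_norm Measurable.of_discrete.aestronglyMeasurable]
    refine Integrable.congr hf (ae_of_all _ fun ξ => ?_)
    simp only [norm_mul, Complex.norm_real, mul_pow]
    rw [Real.norm_of_nonneg (Real.sqrt_nonneg _), Real.sq_sqrt (hw ξ).le, Real.rpow_one, mul_comm]
  refine ⟨hg.toLp _, Lp_count_ext fun ξ => ?_⟩
  rw [multiplier_apply, plancherel_apply, coeFn_toLp_count, mul_div_cancel_right₀]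
  exact_mod_cast (Real.sqrt_pos.2 (hw ξ)).ne'

end Fourier

end SobolevGroup

end

theorem theorem4p1 {G : Type*} [CommGroup G] [TopologicalSpace G] [IsTopologicalGroup G]
    [CompactSpace G] [T2Space G] [MeasurableSpace G] [BorelSpace G]
    (μ : Measure G) [μ.IsHaarMeasure] [μ.Regular] [IsProbabilityMeasure μ]
    (p : SobolevGroup.InvariantPseudoMetric (PontryaginDual G)) :
    SobolevGroup.IsCompactlyEmbedded (SobolevGroup.sobolevSpace μ p 1)
        (SobolevGroup.sobolevNorm μ p 1) ↔
      IsCompactOperator (SobolevGroup.multiplier p) := by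
  open SobolevGroup in
  constructor
  · rintro ⟨-, h⟩
    refine (isCompactOperator_iff_isCompact_closure_image_closedBall
      (multiplier p).toLinearMap zero_lt_one).2 (isCompact_closure_of_subseq fun u hu => ?_)
    choose g hg hgu using hu
    -- The inverse Plancherel transform of `T (g n)` has Sobolev norm `‖g n‖ ≤ 1`.
    have hmem : ∀ n, _ := fun n => mem_sobolevSpace_of_multiplier_eq (μ := μ) p
      ((plancherel μ).apply_symm_apply (multiplier p (g n))).symm
    obtain ⟨a, φ, hφ, ha⟩ := h _ (fun n => (hmem n).1)
      ⟨1, fun n => (hmem n).2.le.trans (mem_closedBall_zero_iff.1 (hg n))⟩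
    refine ⟨plancherel μ a, φ, hφ, ?_⟩
    refine (((plancherel μ).continuous.tendsto a).comp ha).congr fun n => ?_
    rw [Function.comp_apply, LinearIsometryEquiv.apply_symm_apply]
    exact hgu (φ n)
  · intro hT
    -- The embedding constant is `1` because `T` is a contraction.
    refine ⟨⟨1, fun f hf => ?_⟩, fun u hu ⟨R, hR⟩ => ?_⟩
    · obtain ⟨g, hg⟩ := exists_multiplier_eq p hf
      rw [one_mul, (mem_sobolevSpace_of_multiplier_eq p hg).2, ← (plancherel μ).norm_map, ← hg]
      exact norm_multiplier_apply_le p g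
    · choose g hg using fun n => exists_multiplier_eq p (hu n)
      have hc := IsCompactOperator.isCompact_closure_image_closedBall
        (f := (multiplier p).toLinearMap) hT R
      obtain ⟨a, -, φ, hφ, ha⟩ := hc.tendsto_subseq (x := fun n => multiplier p (g n)) fun n =>
        subset_closure ⟨g n, mem_closedBall_zero_iff.2
          ((mem_sobolevSpace_of_multiplier_eq p (hg n)).2 ▸ hR n), rfl⟩
      refine ⟨(plancherel μ).symm a, φ, hφ, ?_⟩
      refine (((plancherel μ).symm.continuous.tendsto a).comp ha).congr fun n => ?_
      simp only [Function.comp_apply, hg, LinearIsometryEquiv.symm_apply_apply]
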